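/- For a real number $B\geq 2$, let $N(B)$ be the number of triples $(a,b,c)\in\mathbb{Z}^3$ with $|a|,|b|,|c|\leq B$ for which there is a polynomial $R\in\mathbb{Z}[x]$ of odd degree such that $\operatorname{Res}(R,ax^2+bx+c)=\pm 1$. Here, for $R$ of degree $n$, the resultant is the determinant of the $(n+2)\times(n+2)$ Sylvester matrix of $R$ and $ax^2+bx+c$, the latter being treated as a polynomial of formal degree $2$ (also when $a=0$). Then there is an absolute constant $K>0$ such that $$N(B)\leq K\,\frac{B^3}{\sqrt{\log B}}\qquad\text{for all real } B\geq 2.$$ -/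

import Mathlib

open Polynomial in
/-- The integer polynomial `a x ^ 2 + b x + c`. -/
noncomputable def quadPoly (a b c : ℤ) : ℤ[X] := C a * X ^ 2 + C b * X + C c

/-- The resultant of `R` (of degree `n`) with `a x ^ 2 + b x + c`: the determinant of the
`(n + 2) × (n + 2)` Sylvester matrix. The second polynomial is always given the formal degree `2`,
also when `a = 0`. -/
noncomputable def quadRes (R : Polynomial ℤ) (a b c : ℤ) : ℤ :=
  Polynomial.resultant R (quadPoly a b c) R.natDegree 2

/-- The integer triples `(a, b, c)` of height at most `B` for which some integer polynomial of odd
degree has resultant `1` or `-1` with `a x ^ 2 + b x + c`. -/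
def resTriples (B : ℝ) : Set (ℤ × ℤ × ℤ) :=
  {t | |(t.1 : ℝ)| ≤ B ∧ |(t.2.1 : ℝ)| ≤ B ∧ |(t.2.2 : ℝ)| ≤ B ∧
    ∃ R : Polynomial ℤ, Odd R.natDegree ∧
      (quadRes R t.1 t.2.1 t.2.2 = 1 ∨ quadRes R t.1 t.2.1 t.2.2 = -1)}

/-- The set being counted is finite, so that `Set.ncard` is its true cardinality. -/
theorem resTriples_finite (B : ℝ) : (resTriples B).Finite := by
  have key : ∀ x : ℤ, |(x : ℝ)| ≤ B → x ∈ Set.Icc (-⌊B⌋) ⌊B⌋ := by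
    intro x hx
    have h := abs_le.mp hx
    refine ⟨?_, Int.le_floor.mpr h.2⟩
    have : -x ≤ ⌊B⌋ := Int.le_floor.mpr (by push_cast; linarith [h.1])
    linarith
  refine ((Set.finite_Icc (-⌊B⌋) ⌊B⌋).prod
    ((Set.finite_Icc (-⌊B⌋) ⌊B⌋).prod (Set.finite_Icc (-⌊B⌋) ⌊B⌋))).subset ?_
  rintro ⟨a, b, c⟩ ⟨ha, hb, hc, -⟩
  exact ⟨key a ha, key b hb, key c hc⟩

/-- The counting function `N(B)`. -/
noncomputable def countN (B : ℝ) : ℕ := (resTriples B).ncard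

/-! Fix the sign `ε` of the resultant. If a quadratic is `η * ℓ ^ 2` modulo an odd prime `p`, with
`ℓ` linear, its resultant with `R` of odd degree `n` is `η ^ n * w ^ 2`. Were this `ε`, then `ε * η`
would be a square; so for `η` with `ε * η` a nonresidue these forms are excluded
(`ne_mul_sq_of_quadRes`). They fill at least `p ^ 2 / 2` of the `p ^ 3` classes
(`sq_le_two_mul_card_mulSqForms`), a density of about `1 / (2 * p)` at every odd prime: a sieve of
dimension one half, which saves `√(log B)`.

The sieve is a large sieve by orthogonality. For each `p` take `φ p` of mean zero, equal to `-1` on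
the excluded set and to a constant `h p` off it. Products of the `φ p` over distinct sets of primes
are nearly orthogonal on a cube, while on the sifted set their sum is the constant `G = ∑ ∏ h p`.
Comparing second moments gives `card S * G ^ 2 ≤ N ^ 3 * G` plus an error
(`card_mul_sq_le_of_eq_on`). Finally `h p ≥ 1 / (2 * p)` forces `G ^ 2 ≥ log (z + 1) / 3`
(`sum_inv_prod_le_sq_sum`, `log_le_three_mul_sum_inv_prod`). -/

/-! ### Periodic functions on cubes -/

/-- The reduction of an integer vector modulo `n`. -/
def redMod {ι : Type*} (n : ℕ) (x : ι → ℤ) : ι → ZMod n := fun i => (x i : ZMod n)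

/-- The cube of side `N` whose least corner has all coordinates equal to `M`. -/
noncomputable def intCube (ι : Type*) [Fintype ι] [DecidableEq ι] (M : ℤ) (N : ℕ) : Finset (ι → ℤ) :=
  Fintype.piFinset fun _ => Finset.Ico M (M + N)

theorem card_intCube (ι : Type*) [Fintype ι] [DecidableEq ι] (M : ℤ) (N : ℕ) :
    (intCube ι M N).card = N ^ Fintype.card ι := by
  simp [intCube]

theorem card_Ico_filter_intCast_eq (d k : ℕ) [NeZero d] (M : ℤ) (y : ZMod d) :
    ((Finset.Ico M (M + (d * k : ℕ))).filter fun x : ℤ => (x : ZMod d) = y).card = k := by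
  have hd : (0 : ℤ) < d := by exact_mod_cast Nat.pos_of_ne_zero (NeZero.ne d)
  have hd' : (d : ℚ) ≠ 0 := by exact_mod_cast NeZero.ne d
  obtain ⟨v, rfl⟩ := ZMod.intCast_surjective y
  have h := Int.Ico_filter_modEq_card M (M + (d * k : ℕ)) hd v
  have e : ((M + (d * k : ℕ) : ℤ) - v : ℚ) / ((d : ℤ) : ℚ) = (M - v) / (d : ℤ) + (k : ℤ) := by
    push_cast
    field_simp
    ring
  rw [e, Int.ceil_add_intCast] at h
  have h2 : ((Finset.Ico M (M + (d * k : ℕ))).filter fun x : ℤ => (x : ZMod d) = v) =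
      (Finset.Ico M (M + (d * k : ℕ))).filter fun x : ℤ => x ≡ v [ZMOD d] := by
    ext x
    simp [ZMod.intCast_eq_intCast_iff]
  rw [h2]
  apply Nat.cast_injective (R := ℤ)
  rw [h]
  simp

theorem sum_intCube_comp_redMod {ι : Type*} [Fintype ι] [DecidableEq ι] (d k : ℕ) [NeZero d]
    (M : ℤ) (F : (ι → ZMod d) → ℝ) :
    ∑ x ∈ intCube ι M (d * k), F (redMod d x) = (k : ℝ) ^ Fintype.card ι * ∑ y, F y := by
  rw [← Finset.sum_fiberwise (intCube ι M (d * k)) (redMod d), Finset.mul_sum]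
  refine Finset.sum_congr rfl fun y _ => ?_
  have hc : ((intCube ι M (d * k)).filter fun x => redMod d x = y).card =
      k ^ Fintype.card ι := by
    have : ((intCube ι M (d * k)).filter fun x => redMod d x = y) =
        Fintype.piFinset fun i =>
          (Finset.Ico M (M + (d * k : ℕ))).filter fun x : ℤ => (x : ZMod d) = y i := by
      ext x
      simp only [intCube, Finset.mem_filter, Fintype.mem_piFinset, redMod, funext_iff]
      exact forall_and.symm
    rw [this, Fintype.card_piFinset]
    simp only [card_Ico_filter_intCast_eq, Finset.prod_const, Finset.card_univ]
  rw [Finset.sum_congr rfl (g := fun _ => F y), Finset.sum_const, hc]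
  · simp
  · intro x hx
    rw [(Finset.mem_filter.mp hx).2]

theorem sum_mul_comp_cast {ι : Type*} [Fintype ι] [DecidableEq ι] (m n : ℕ) [NeZero m] [NeZero n]
    [NeZero (m * n)] (h : m.Coprime n) (F : (ι → ZMod m) → ℝ) (G : (ι → ZMod n) → ℝ) :
    ∑ y : ι → ZMod (m * n), F (fun i => (y i).cast) * G (fun i => (y i).cast) =
      (∑ y, F y) * ∑ y, G y := by
  rw [Finset.sum_mul_sum, ← Fintype.sum_prod_type']
  refine Fintype.sum_equiv ((Equiv.piCongrRight fun _ => (ZMod.chineseRemainder h).toEquiv).trans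
    (Equiv.arrowProdEquivProdArrow ι (fun _ => ZMod m) (fun _ => ZMod n))) _ _ fun y => ?_
  have h1 : ∀ z : ZMod (m * n), (ZMod.chineseRemainder h z).1 = z.cast := fun z => by
    obtain ⟨v, rfl⟩ := ZMod.intCast_surjective z
    rw [ZMod.cast_intCast (Dvd.intro _ rfl), map_intCast, Prod.fst_intCast]
  have h2 : ∀ z : ZMod (m * n), (ZMod.chineseRemainder h z).2 = z.cast := fun z => by
    obtain ⟨v, rfl⟩ := ZMod.intCast_surjective z
    rw [ZMod.cast_intCast (Dvd.intro_left _ rfl), map_intCast, Prod.snd_intCast]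
  simp [Equiv.arrowProdEquivProdArrow, h1, h2]

theorem sum_prod_comp_cast {ι κ : Type*} [Fintype ι] [DecidableEq ι] [DecidableEq κ] {q : κ → ℕ}
    [∀ k, NeZero (q k)] (hq : Pairwise fun i j => (q i).Coprime (q j)) (u : Finset κ)
    (F : ∀ k, (ι → ZMod (q k)) → ℝ) (d : ℕ) [NeZero d] (hd : d = ∏ k ∈ u, q k) :
    ∑ y : ι → ZMod d, ∏ k ∈ u, F k (fun i => (y i).cast) = ∏ k ∈ u, ∑ y, F k y := by
  induction u using Finset.induction_on generalizing d with
  | empty =>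
    simp only [Finset.prod_empty] at hd ⊢
    subst hd
    simp
  | insert k u hk ih =>
    have hn : NeZero (∏ j ∈ u, q j) := ⟨Finset.prod_ne_zero_iff.mpr fun j _ => NeZero.ne _⟩
    rw [Finset.prod_insert hk] at hd
    subst hd
    have hcop : Nat.Coprime (q k) (∏ j ∈ u, q j) :=
      Nat.Coprime.prod_right fun j hj => hq fun h => hk (h ▸ hj)
    rw [Finset.prod_insert hk, ← ih _ rfl, ← sum_mul_comp_cast _ _ hcop]
    refine Finset.sum_congr rfl fun y _ => ?_
    rw [Finset.prod_insert hk]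
    congr 1
    refine Finset.prod_congr rfl fun j hj => congrArg _ (funext fun i => ?_)
    have hj' := Finset.dvd_prod_of_mem q hj
    obtain ⟨v, hv⟩ := ZMod.intCast_surjective (y i)
    change (y i).cast = ((y i).cast : ZMod (∏ j ∈ u, q j)).cast
    rw [← hv, ZMod.cast_intCast (hj'.mul_left _), ZMod.cast_intCast (Dvd.intro_left _ rfl),
      ZMod.cast_intCast hj']

/-- The largest subcube whose side is a multiple of `d` consists of complete residue systems. The
rest has at most `N ^ 3 - (N - d) ^ 3 ≤ 3 * N ^ 2 * d` points when `d ≤ N`; for `d > N` the subcube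
is empty and the bound is trivial. -/
theorem sum_intCube_le_of_periodic (d : ℕ) [NeZero d] (M : ℤ) (N : ℕ)
    (F : (Fin 3 → ZMod d) → ℝ) (hF : ∀ y, |F y| ≤ 1) :
    ∑ x ∈ intCube (Fin 3) M N, F (redMod d x) ≤
      ((N / d : ℕ) : ℝ) ^ 3 * ∑ y, F y + 3 * N ^ 2 * d := by
  have hle : d * (N / d) ≤ N := Nat.mul_div_le N d
  have hsub : intCube (Fin 3) M (d * (N / d)) ⊆ intCube (Fin 3) M N := by
    refine Fintype.piFinset_subset _ _ fun _ => Finset.Ico_subset_Ico_right ?_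
    exact_mod_cast Int.add_le_add_left (Int.ofNat_le.mpr hle) M
  rw [← Finset.sum_sdiff hsub, sum_intCube_comp_redMod, add_comm, Fintype.card_fin]
  gcongr
  calc ∑ x ∈ intCube (Fin 3) M N \ intCube (Fin 3) M (d * (N / d)), F (redMod d x)
      ≤ ∑ x ∈ intCube (Fin 3) M N \ intCube (Fin 3) M (d * (N / d)), (1 : ℝ) :=
        Finset.sum_le_sum fun x _ => (abs_le.mp (hF _)).2
    _ = (N : ℝ) ^ 3 - (d * (N / d) : ℕ) ^ 3 := by
        rw [Finset.sum_const, Finset.card_sdiff_of_subset hsub, card_intCube, card_intCube,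
          Fintype.card_fin, nsmul_one, Nat.cast_sub (Nat.pow_le_pow_left hle 3)]
        push_cast
        ring
    _ ≤ 3 * N ^ 2 * d := by
        have h1 : (N : ℝ) ≤ (d * (N / d) : ℕ) + d := by
          have h := Nat.div_add_mod N d
          have h' := Nat.mod_lt N (Nat.pos_of_ne_zero (NeZero.ne d))
          exact_mod_cast (by omega : N ≤ d * (N / d) + d)
        have h2 : ((d * (N / d) : ℕ) : ℝ) ≤ N := by exact_mod_cast hle
        have h3 : (0 : ℝ) ≤ (d * (N / d) : ℕ) := Nat.cast_nonneg _
        generalize ((d * (N / d) : ℕ) : ℝ) = e at *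
        have hN : (0 : ℝ) ≤ N := Nat.cast_nonneg N
        have h4 : (N : ℝ) ^ 2 + N * e + e ^ 2 ≤ 3 * N ^ 2 := by nlinarith
        calc (N : ℝ) ^ 3 - e ^ 3 = (N ^ 2 + N * e + e ^ 2) * (N - e) := by ring
          _ ≤ (3 * N ^ 2) * (N - e) := by gcongr
          _ ≤ (3 * N ^ 2) * d := by gcongr; linarith

/-! ### The sieve by mean-zero functions -/

section Sieve

variable {κ : Type*} [DecidableEq κ] {q : κ → ℕ} [∀ k, NeZero (q k)]

/-- Near-orthogonality: the complete sum factors over the moduli, and any `k` lying in just one of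
`s` and `t` contributes the factor `∑ y, φ k y = 0`. -/
theorem sum_intCube_prod_mul_prod_le (hq : Pairwise fun i j => (q i).Coprime (q j))
    (φ : ∀ k, (Fin 3 → ZMod (q k)) → ℝ) (h : κ → ℝ) (h0 : ∀ k, ∑ y, φ k y = 0)
    (h2 : ∀ k, ∑ y, φ k y ^ 2 = (q k : ℝ) ^ 3 * h k) (h1 : ∀ k y, |φ k y| ≤ 1)
    (hh : ∀ k, 0 ≤ h k) (s t : Finset κ) (M : ℤ) (N : ℕ) :
    ∑ x ∈ intCube (Fin 3) M N,
        (∏ k ∈ s, φ k (redMod (q k) x)) * ∏ k ∈ t, φ k (redMod (q k) x) ≤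
      (if s = t then (N : ℝ) ^ 3 * ∏ k ∈ s, h k else 0) + 3 * N ^ 2 * ∏ k ∈ s ∪ t, (q k : ℝ) := by
  let F : ∀ k, (Fin 3 → ZMod (q k)) → ℝ := fun k y =>
    (if k ∈ s then φ k y else 1) * (if k ∈ t then φ k y else 1)
  let d := ∏ k ∈ s ∪ t, q k
  have : NeZero d := ⟨Finset.prod_ne_zero_iff.mpr fun j _ => NeZero.ne _⟩
  have hF : ∀ k y, |F k y| ≤ 1 := by
    intro k y
    have := h1 k y
    have h' : φ k y * φ k y ≤ 1 := by
      rw [← abs_mul_abs_self]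
      nlinarith [abs_nonneg (φ k y)]
    by_cases hs : k ∈ s <;> by_cases ht : k ∈ t <;> simp [F, hs, ht, abs_mul, this, h']
  have key : ∀ x : Fin 3 → ℤ,
      (∏ k ∈ s, φ k (redMod (q k) x)) * ∏ k ∈ t, φ k (redMod (q k) x) =
        ∏ k ∈ s ∪ t, F k (fun i => (redMod d x i).cast) := by
    intro x
    have hx : ∀ k ∈ s ∪ t, F k (fun i => (redMod d x i).cast) =
        (if k ∈ s then φ k (redMod (q k) x) else 1) *
          (if k ∈ t then φ k (redMod (q k) x) else 1) := by
      intro k hk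
      have : (fun i => (redMod d x i).cast) = redMod (q k) x := by
        funext i
        exact ZMod.cast_intCast (Finset.dvd_prod_of_mem q hk) _
      rw [this]
    rw [Finset.prod_congr rfl hx, Finset.prod_mul_distrib, Finset.prod_ite_mem,
      Finset.prod_ite_mem, Finset.inter_eq_right.mpr Finset.subset_union_left,
      Finset.inter_eq_right.mpr Finset.subset_union_right]
  rw [Finset.sum_congr rfl fun x _ => key x]
  refine (sum_intCube_le_of_periodic d M N
    (fun y => ∏ k ∈ s ∪ t, F k (fun i => (y i).cast)) fun y => ?_).trans ?_
  · rw [Finset.abs_prod]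
    exact Finset.prod_le_one (fun _ _ => abs_nonneg _) fun _ _ => hF _ _
  · rw [sum_prod_comp_cast hq (s ∪ t) F d rfl]
    have hd : (d : ℝ) = ∏ k ∈ s ∪ t, (q k : ℝ) := by simp [d]
    rw [← hd]
    gcongr
    split_ifs with hst
    · subst hst
      have : ∏ k ∈ s ∪ s, ∑ y, F k y = (d : ℝ) ^ 3 * ∏ k ∈ s, h k := by
        rw [hd, Finset.union_self, ← Finset.prod_pow, ← Finset.prod_mul_distrib]
        refine Finset.prod_congr rfl fun k hk => ?_
        rw [← h2 k]
        exact Finset.sum_congr rfl fun y _ => by simp [F, hk, sq]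
      rw [this, ← mul_assoc, ← mul_pow]
      have hp : 0 ≤ ∏ k ∈ s, h k := Finset.prod_nonneg fun k _ => hh k
      gcongr
      exact_mod_cast Nat.div_mul_le_self N d
    · have : ∃ k ∈ s ∪ t, ¬ (k ∈ s ∧ k ∈ t) := by
        by_contra! hc
        exact hst (Finset.ext fun k => ⟨fun hk => (hc k (Finset.mem_union_left _ hk)).2,
          fun hk => (hc k (Finset.mem_union_right _ hk)).1⟩)
      obtain ⟨k, hk, hk'⟩ := this
      rw [Finset.prod_eq_zero hk, mul_zero]
      rw [← h0 k]
      refine Finset.sum_congr rfl fun y _ => ?_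
      rcases Finset.mem_union.mp hk with hs | ht
      · have ht : k ∉ t := fun ht => hk' ⟨hs, ht⟩
        simp [F, hs, ht]
      · have hs : k ∉ s := fun hs => hk' ⟨hs, ht⟩
        simp [F, hs, ht]

/-- An upper-bound sieve: a set of lattice points in a cube on which each of the mean-zero
functions `φ k` takes the constant value `h k` is small. -/
theorem card_mul_sq_le_of_eq_on (hq : Pairwise fun i j => (q i).Coprime (q j))
    (φ : ∀ k, (Fin 3 → ZMod (q k)) → ℝ) (h : κ → ℝ) (h0 : ∀ k, ∑ y, φ k y = 0)
    (h2 : ∀ k, ∑ y, φ k y ^ 2 = (q k : ℝ) ^ 3 * h k) (h1 : ∀ k y, |φ k y| ≤ 1)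
    (hh : ∀ k, 0 ≤ h k) (D : Finset (Finset κ)) (z : ℕ) (hDz : ∀ s ∈ D, ∏ k ∈ s, q k ≤ z)
    (hD : D.card ≤ z) (M : ℤ) (N : ℕ) (S : Finset (Fin 3 → ℤ)) (hS : S ⊆ intCube (Fin 3) M N)
    (hφ : ∀ x ∈ S, ∀ s ∈ D, ∀ k ∈ s, φ k (redMod (q k) x) = h k) :
    S.card * (∑ s ∈ D, ∏ k ∈ s, h k) ^ 2 ≤
      (N : ℝ) ^ 3 * (∑ s ∈ D, ∏ k ∈ s, h k) + 3 * N ^ 2 * z ^ 4 := by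
  calc S.card * (∑ s ∈ D, ∏ k ∈ s, h k) ^ 2
      = ∑ x ∈ S, (∑ s ∈ D, ∏ k ∈ s, φ k (redMod (q k) x)) ^ 2 := by
        rw [← nsmul_eq_mul, ← Finset.sum_const]
        refine Finset.sum_congr rfl fun x hx => ?_
        congr 1
        exact Finset.sum_congr rfl fun s hs => Finset.prod_congr rfl fun k hk =>
          (hφ x hx s hs k hk).symm
    -- Since the summand is a square, the sum may be extended from `S` to the whole cube.
    _ ≤ ∑ x ∈ intCube (Fin 3) M N, (∑ s ∈ D, ∏ k ∈ s, φ k (redMod (q k) x)) ^ 2 :=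
        Finset.sum_le_sum_of_subset_of_nonneg hS fun _ _ _ => sq_nonneg _
    _ = ∑ s ∈ D, ∑ t ∈ D, ∑ x ∈ intCube (Fin 3) M N,
        (∏ k ∈ s, φ k (redMod (q k) x)) * ∏ k ∈ t, φ k (redMod (q k) x) := by
        simp_rw [sq, Finset.sum_mul_sum]
        rw [Finset.sum_comm]
        exact Finset.sum_congr rfl fun s _ => Finset.sum_comm
    _ ≤ ∑ s ∈ D, ∑ t ∈ D, ((if s = t then (N : ℝ) ^ 3 * ∏ k ∈ s, h k else 0) +
        3 * N ^ 2 * z ^ 2) := by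
        refine Finset.sum_le_sum fun s hs => Finset.sum_le_sum fun t ht => ?_
        refine (sum_intCube_prod_mul_prod_le hq φ h h0 h2 h1 hh s t M N).trans ?_
        gcongr
        have : ∏ k ∈ s ∪ t, q k ≤ z ^ 2 := by
          have hpos : 0 < ∏ k ∈ s ∩ t, q k :=
            Nat.pos_of_ne_zero (Finset.prod_ne_zero_iff.mpr fun j _ => NeZero.ne _)
          calc ∏ k ∈ s ∪ t, q k ≤ (∏ k ∈ s ∪ t, q k) * ∏ k ∈ s ∩ t, q k :=
                Nat.le_mul_of_pos_right _ hpos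
            _ = (∏ k ∈ s, q k) * ∏ k ∈ t, q k := Finset.prod_union_inter
            _ ≤ z * z := Nat.mul_le_mul (hDz s hs) (hDz t ht)
            _ = z ^ 2 := (sq z).symm
        exact_mod_cast this
    _ = (N : ℝ) ^ 3 * (∑ s ∈ D, ∏ k ∈ s, h k) + 3 * N ^ 2 * z ^ 2 * (D.card : ℝ) ^ 2 := by
        simp_rw [Finset.sum_add_distrib, Finset.sum_const, nsmul_eq_mul]
        rw [Finset.mul_sum]
        congr 1
        · refine Finset.sum_congr rfl fun s hs => ?_
          rw [Finset.sum_ite_eq, if_pos hs]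
        · ring
    _ ≤ (N : ℝ) ^ 3 * (∑ s ∈ D, ∏ k ∈ s, h k) + 3 * N ^ 2 * z ^ 2 * (z : ℝ) ^ 2 := by
        gcongr
    _ = _ := by ring

end Sieve

/-! ### Sums over odd squarefree numbers -/

/-- The odd prime numbers. -/
abbrev OddPrime : Type := {p : ℕ // p.Prime ∧ p ≠ 2}

instance (p : OddPrime) : NeZero (p : ℕ) := ⟨p.2.1.ne_zero⟩

/-- The finite sets of odd primes whose product is at most `z`. -/
noncomputable def oddPrimeSets (z : ℕ) : Finset (Finset OddPrime) :=
  ((Finset.range (z + 1)).subtype fun p => p.Prime ∧ p ≠ 2).powerset.filter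
    fun s => ∏ p ∈ s, (p : ℕ) ≤ z

theorem mem_oddPrimeSets {z : ℕ} {s : Finset OddPrime} :
    s ∈ oddPrimeSets z ↔ ∏ p ∈ s, (p : ℕ) ≤ z := by
  refine ⟨fun h => (Finset.mem_filter.mp h).2, fun h => Finset.mem_filter.mpr ⟨?_, h⟩⟩
  refine Finset.mem_powerset.mpr fun p hp => ?_
  rw [Finset.mem_subtype, Finset.mem_range, Nat.lt_succ_iff]
  refine (Nat.le_of_dvd ?_ (Finset.dvd_prod_of_mem (fun p : OddPrime => (p : ℕ)) hp)).trans h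
  exact Finset.prod_pos fun p _ => p.2.1.pos

theorem mem_oddPrimeSets_of_subset {z : ℕ} {s t : Finset OddPrime} (h : s ⊆ t)
    (ht : t ∈ oddPrimeSets z) : s ∈ oddPrimeSets z :=
  mem_oddPrimeSets.mpr <| (Finset.prod_le_prod_of_subset_of_one_le' h
    fun p _ _ => p.2.1.one_le).trans (mem_oddPrimeSets.mp ht)

theorem prod_oddPrime_injective :
    Function.Injective fun s : Finset OddPrime => ∏ p ∈ s, (p : ℕ) := by
  have key : ∀ s : Finset OddPrime, (∏ p ∈ s, (p : ℕ)).primeFactors =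
      s.map (Function.Embedding.subtype _) := by
    intro s
    have h := Nat.primeFactors_prod (s := s.map (Function.Embedding.subtype _)) (by
      intro p hp
      obtain ⟨q, _, rfl⟩ := Finset.mem_map.mp hp
      exact q.2.1)
    rwa [Finset.prod_map] at h
  intro s t h
  have h' := congrArg Nat.primeFactors h
  simp only [key] at h'
  exact Finset.map_injective _ h'

theorem card_oddPrimeSets_le (z : ℕ) : (oddPrimeSets z).card ≤ z := by
  calc (oddPrimeSets z).card ≤ (Finset.Icc 1 z).card :=
        Finset.card_le_card_of_injOn (fun s => ∏ p ∈ s, (p : ℕ))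
          (fun s hs => Finset.mem_coe.mpr <| Finset.mem_Icc.mpr
            ⟨Finset.prod_pos fun (p : OddPrime) _ => p.2.1.pos, mem_oddPrimeSets.mp hs⟩)
          prod_oddPrime_injective.injOn
    _ = z := by simp

/-- As `1 / p ≤ h p + h p`, expanding the product over `u` sums over the splittings of `u` into two
disjoint sets. Each such pair determines `u` and occurs in the expanded square. -/
theorem sum_inv_prod_le_sq_sum (z : ℕ) (h : OddPrime → ℝ)
    (hh : ∀ p : OddPrime, 1 / (2 * (p : ℝ)) ≤ h p) :
    ∑ u ∈ oddPrimeSets z, (∏ p ∈ u, (p : ℝ))⁻¹ ≤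
      (∑ s ∈ oddPrimeSets z, ∏ p ∈ s, h p) ^ 2 := by
  have h0 : ∀ p, 0 ≤ h p := fun p => le_trans (by positivity) (hh p)
  have hinj : Set.InjOn (fun x : (_ : Finset OddPrime) × Finset OddPrime => (x.2, x.1 \ x.2))
      ((oddPrimeSets z).sigma fun u => u.powerset : Finset _) := by
    rintro ⟨u, s⟩ hx ⟨v, t⟩ hy hxy
    simp only [Finset.coe_sigma, Set.mem_sigma_iff, Finset.mem_coe, Finset.mem_powerset] at hx hy
    obtain ⟨h1, h2⟩ := Prod.mk.inj hxy
    dsimp only at h1 h2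
    subst h1
    have : u = v := by
      rw [← Finset.sdiff_union_of_subset hx.2, h2, Finset.sdiff_union_of_subset hy.2]
    rw [this]
  calc ∑ u ∈ oddPrimeSets z, (∏ p ∈ u, (p : ℝ))⁻¹
      ≤ ∑ u ∈ oddPrimeSets z, ∑ s ∈ u.powerset, (∏ p ∈ s, h p) * ∏ p ∈ u \ s, h p := by
        refine Finset.sum_le_sum fun u _ => ?_
        rw [← Finset.prod_add, ← Finset.prod_inv_distrib]
        refine Finset.prod_le_prod (fun p _ => by positivity) fun p _ => ?_
        have hp : (0 : ℝ) < p := by exact_mod_cast p.2.1.pos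
        calc ((p : ℝ))⁻¹ = 1 / (2 * (p : ℝ)) + 1 / (2 * (p : ℝ)) := by field_simp; norm_num
          _ ≤ h p + h p := add_le_add (hh p) (hh p)
    _ = ∑ y ∈ ((oddPrimeSets z).sigma fun u => u.powerset).image fun x => (x.2, x.1 \ x.2),
          (∏ p ∈ y.1, h p) * ∏ p ∈ y.2, h p := by
        rw [Finset.sum_image hinj, Finset.sum_sigma]
    _ ≤ ∑ y ∈ oddPrimeSets z ×ˢ oddPrimeSets z, (∏ p ∈ y.1, h p) * ∏ p ∈ y.2, h p := by
        refine Finset.sum_le_sum_of_subset_of_nonneg ?_ fun y _ _ =>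
          mul_nonneg (Finset.prod_nonneg fun p _ => h0 p) (Finset.prod_nonneg fun p _ => h0 p)
        intro y hy
        obtain ⟨⟨u, s⟩, hx, rfl⟩ := Finset.mem_image.mp hy
        rw [Finset.mem_sigma, Finset.mem_powerset] at hx
        exact Finset.mem_product.mpr ⟨mem_oddPrimeSets_of_subset hx.2 hx.1,
          mem_oddPrimeSets_of_subset Finset.sdiff_subset hx.1⟩
    _ = (∑ s ∈ oddPrimeSets z, ∏ p ∈ s, h p) ^ 2 := by
        rw [sq, Finset.sum_mul_sum, Finset.sum_product]

theorem exists_prod_oddPrime_mul_eq {n : ℕ} (hn : n ≠ 0) :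
    ∃ (u : Finset OddPrime) (j k : ℕ), (j = 1 ∨ j = 2) ∧
      (∏ p ∈ u, (p : ℕ)) * j * k ^ 2 = n := by
  obtain ⟨a, b, rfl, ha⟩ := Nat.sq_mul_squarefree n
  have hu : ∏ p ∈ (a.primeFactors.erase 2).subtype (fun p => p.Prime ∧ p ≠ 2), (p : ℕ) =
      ∏ p ∈ a.primeFactors.erase 2, p := by
    refine Finset.prod_subtype_of_mem (fun p => p) fun p hp => ?_
    rw [Finset.mem_erase, Nat.mem_primeFactors] at hp
    exact ⟨hp.2.1, hp.1⟩
  have hprod := Nat.prod_primeFactors_of_squarefree ha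
  by_cases h2 : 2 ∈ a.primeFactors
  · refine ⟨(a.primeFactors.erase 2).subtype fun p => p.Prime ∧ p ≠ 2, 2, b, Or.inr rfl, ?_⟩
    rw [hu, Finset.prod_erase_mul _ _ h2, hprod, mul_comm]
  · refine ⟨(a.primeFactors.erase 2).subtype fun p => p.Prime ∧ p ≠ 2, 1, b, Or.inl rfl, ?_⟩
    rw [hu, Finset.erase_eq_of_notMem h2, hprod, mul_one, mul_comm]

/-- Every `n ≤ z` is an odd squarefree number times `j ∈ {1, 2}` times `k ^ 2`. The harmonic sum is
thus at most the sum over `u` times `(1 + 1 / 2) * ∑ 1 / k ^ 2 ≤ 3 / 2 * 2`. -/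
theorem log_le_three_mul_sum_inv_prod (z : ℕ) :
    Real.log (z + 1) ≤ 3 * ∑ u ∈ oddPrimeSets z, (∏ p ∈ u, (p : ℝ))⁻¹ := by
  let g : Finset OddPrime × ℕ × ℕ → ℕ := fun x => (∏ p ∈ x.1, (p : ℕ)) * x.2.1 * x.2.2 ^ 2
  let T := oddPrimeSets z ×ˢ ({1, 2} : Finset ℕ) ×ˢ Finset.Ioo 0 (z + 1)
  have hsub : Finset.Icc 1 z ⊆ T.image g := by
    intro n hn
    rw [Finset.mem_Icc] at hn
    obtain ⟨u, j, k, hj, h⟩ := exists_prod_oddPrime_mul_eq (n := n) (by omega)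
    have hu : 0 < ∏ p ∈ u, (p : ℕ) := Finset.prod_pos fun p _ => p.2.1.pos
    have hk : 0 < k := Nat.pos_of_ne_zero fun h0 => by simp [h0] at h; omega
    have hj0 : 0 < j := by omega
    have h1 : (∏ p ∈ u, (p : ℕ)) ∣ n := ⟨j * k ^ 2, by rw [← h, mul_assoc]⟩
    have h2 : k ∣ n := ⟨(∏ p ∈ u, (p : ℕ)) * j * k, by rw [← h]; ring⟩
    have h1' := Nat.le_of_dvd (by omega) h1
    have h2' := Nat.le_of_dvd (by omega) h2
    refine Finset.mem_image.mpr ⟨(u, j, k), ?_, h⟩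
    simp only [T, Finset.mem_product, Finset.mem_insert, Finset.mem_singleton, Finset.mem_Ioo,
      mem_oddPrimeSets]
    exact ⟨h1'.trans hn.2, hj, hk, by omega⟩
  calc Real.log (z + 1) ≤ (harmonic z : ℝ) := by
        exact_mod_cast log_add_one_le_harmonic z
    _ = ∑ n ∈ Finset.Icc 1 z, ((n : ℝ))⁻¹ := by
        rw [harmonic_eq_sum_Icc]
        push_cast
        rfl
    _ ≤ ∑ n ∈ T.image g, ((n : ℝ))⁻¹ :=
        Finset.sum_le_sum_of_subset_of_nonneg hsub fun _ _ _ => by positivity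
    _ ≤ ∑ x ∈ T, ((g x : ℕ) : ℝ)⁻¹ :=
        Finset.sum_image_le_of_nonneg fun _ _ => by positivity
    _ = (∑ u ∈ oddPrimeSets z, (∏ p ∈ u, (p : ℝ))⁻¹) *
          ((∑ j ∈ ({1, 2} : Finset ℕ), ((j : ℝ))⁻¹) *
            ∑ k ∈ Finset.Ioo 0 (z + 1), ((k : ℝ) ^ 2)⁻¹) := by
        rw [Finset.sum_mul_sum (s := {1, 2}), Finset.sum_mul, Finset.sum_product]
        refine Finset.sum_congr rfl fun u _ => ?_
        rw [Finset.mul_sum, Finset.sum_product]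
        refine Finset.sum_congr rfl fun j _ => ?_
        rw [Finset.mul_sum]
        refine Finset.sum_congr rfl fun k _ => ?_
        simp only [g]
        push_cast
        rw [mul_inv, mul_inv, mul_assoc]
    _ ≤ (∑ u ∈ oddPrimeSets z, (∏ p ∈ u, (p : ℝ))⁻¹) * (3 / 2 * 2) := by
        have h1 : ∑ j ∈ ({1, 2} : Finset ℕ), ((j : ℝ))⁻¹ = 3 / 2 := by norm_num
        have h2 := sum_Ioo_inv_sq_le (α := ℝ) 0 (z + 1)
        rw [h1]
        gcongr
        simpa using h2
    _ = _ := by ring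

/-! ### The local obstruction and the size of the excluded sets -/

-- Multiplicativity gives the square of a resultant with the linear form. If `r = 0`, the formal
-- degree exceeds the true one by two, which contributes the square of `R.coeff n`.
open Polynomial in
theorem resultant_C_mul_linear_sq {K : Type*} [Field K] (R : K[X]) (n : ℕ) (hn : R.natDegree ≤ n)
    (η r s : K) : ∃ w, resultant R (C η * (C r * X + C s) ^ 2) n 2 = η ^ n * w ^ 2 := by
  rw [resultant_C_mul_right]
  by_cases hr : r = 0
  · refine ⟨R.coeff n * s ^ n, ?_⟩
    rw [hr, map_zero, zero_mul, zero_add, ← C_pow, resultant_C_right]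
    ring
  · refine ⟨resultant R (C r * X + C s) n 1, ?_⟩
    have hd : (C r * X + C s).natDegree = 1 := natDegree_linear hr
    have h := resultant_mul_right R (C r * X + C s) (C r * X + C s) n hn
    rw [hd] at h
    rw [sq (C r * X + C s), h, sq]

/-- The reduction modulo `p` of a quadratic polynomial whose resultant with some polynomial of odd
degree is a sign `ε` is never `η` times a square when `ε * η` is a nonresidue. -/
theorem ne_mul_sq_of_quadRes {p : ℕ} [Fact p.Prime] {R : Polynomial ℤ} (hR : Odd R.natDegree)
    {a b c ε : ℤ} (hε : ε = 1 ∨ ε = -1) (h : quadRes R a b c = ε) {η : ZMod p}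
    (hη : ¬ IsSquare (ε * η)) (r s : ZMod p) :
    ¬ ((a : ZMod p) = η * r ^ 2 ∧ (b : ZMod p) = η * (2 * r * s) ∧ (c : ZMod p) = η * s ^ 2) := by
  rintro ⟨ha, hb, hc⟩
  have hmap : (quadPoly a b c).map (Int.castRingHom (ZMod p)) =
      Polynomial.C η * (Polynomial.C r * Polynomial.X + Polynomial.C s) ^ 2 := by
    simp only [quadPoly, Polynomial.map_add, Polynomial.map_mul, Polynomial.map_pow,
      Polynomial.map_X, Polynomial.map_C]
    simp only [eq_intCast, ha, hb, hc, map_mul, map_pow, map_ofNat]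
    ring
  have h1 := Polynomial.resultant_map_map R (quadPoly a b c) R.natDegree 2
    (Int.castRingHom (ZMod p))
  rw [hmap] at h1
  obtain ⟨w, hw⟩ := resultant_C_mul_linear_sq (R.map (Int.castRingHom (ZMod p))) R.natDegree
    Polynomial.natDegree_map_le η r s
  rw [hw] at h1
  change _ = Int.castRingHom (ZMod p) (quadRes R a b c) at h1
  rw [h, eq_intCast] at h1
  obtain ⟨m, hm⟩ := hR
  rw [hm] at h1
  have hε2 : (ε : ZMod p) * ε = 1 := by rcases hε with rfl | rfl <;> simp
  -- From `η ^ (2 * m + 1) * w ^ 2 = ε` follows `ε * η * (η ^ m * w) ^ 2 = ε ^ 2 = 1`.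
  refine hη ⟨(η ^ m * w)⁻¹, ?_⟩
  rw [← mul_inv]
  refine eq_inv_of_mul_eq_one_left ?_
  linear_combination (ε : ZMod p) * h1 + hε2

/-- The coefficient vectors of `η` times the square of a linear form. -/
noncomputable def mulSqForms {p : ℕ} [NeZero p] (η : ZMod p) : Finset (Fin 3 → ZMod p) :=
  Finset.univ.image fun x : ZMod p × ZMod p => ![η * x.1 ^ 2, η * (2 * x.1 * x.2), η * x.2 ^ 2]

theorem card_mulSqForms_le {p : ℕ} [NeZero p] (η : ZMod p) : (mulSqForms η).card ≤ p ^ 2 := by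
  refine Finset.card_image_le.trans ?_
  rw [Finset.card_univ, Fintype.card_prod, ZMod.card, sq]

/-- For `p` odd and `η ≠ 0`, the form determines `(r, s)` up to a common sign, so fibres have at
most two elements. -/
theorem sq_le_two_mul_card_mulSqForms {p : ℕ} [Fact p.Prime] (hp : p ≠ 2) {η : ZMod p}
    (hη : η ≠ 0) : p ^ 2 ≤ 2 * (mulSqForms η).card := by
  have h2 : (2 : ZMod p) ≠ 0 := Ring.two_ne_zero (by rwa [ZMod.ringChar_zmod_n])
  have hc : (Finset.univ : Finset (ZMod p × ZMod p)).card = p ^ 2 := by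
    rw [Finset.card_univ, Fintype.card_prod, ZMod.card, sq]
  rw [← hc]
  refine Finset.card_le_mul_card_image _ 2 fun y hy => ?_
  obtain ⟨⟨r, s⟩, _, rfl⟩ := Finset.mem_image.mp hy
  refine le_trans (Finset.card_le_card (t := {(r, s), (-r, -s)}) ?_) Finset.card_le_two
  rintro ⟨r', s'⟩ hx
  have hx := (Finset.mem_filter.mp hx).2
  have e0 : η * r' ^ 2 = η * r ^ 2 := congrFun hx 0
  have e1 : η * (2 * r' * s') = η * (2 * r * s) := congrFun hx 1
  have e2 : η * s' ^ 2 = η * s ^ 2 := congrFun hx 2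
  replace e0 := mul_left_cancel₀ hη e0
  replace e1 := mul_left_cancel₀ hη e1
  replace e2 := mul_left_cancel₀ hη e2
  rw [mul_assoc, mul_assoc] at e1
  replace e1 := mul_left_cancel₀ h2 e1
  simp only [Finset.mem_insert, Finset.mem_singleton, Prod.mk.injEq]
  by_cases hr : r = 0
  · subst hr
    have hr' : r' = 0 := by simpa using e0
    rcases sq_eq_sq_iff_eq_or_eq_neg.mp e2 with h | h
    · exact Or.inl ⟨hr', h⟩
    · exact Or.inr ⟨by simp [hr'], h⟩
  · rcases sq_eq_sq_iff_eq_or_eq_neg.mp e0 with h | h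
    · subst h
      exact Or.inl ⟨rfl, mul_left_cancel₀ hr e1⟩
    · subst h
      exact Or.inr ⟨rfl, mul_left_cancel₀ hr (by linear_combination -e1)⟩

/-! ### The local weights -/

/-- The value off `Ω` of the mean-zero function that is `-1` on `Ω ⊆ (ZMod p) ^ 3`. -/
noncomputable def balance (p : ℕ) (w : ℕ) : ℝ := w / ((p : ℝ) ^ 3 - w)

theorem balance_bounds {p w : ℕ} (hp : 2 ≤ p) (h1 : p ^ 2 ≤ 2 * w) (h2 : w ≤ p ^ 2) :
    0 < (p : ℝ) ^ 3 - w ∧ 1 / (2 * (p : ℝ)) ≤ balance p w ∧ balance p w ≤ 1 := by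
  have hp' : (2 : ℝ) ≤ p := by exact_mod_cast hp
  have h1' : (p : ℝ) ^ 2 ≤ 2 * w := by exact_mod_cast h1
  have h2' : (w : ℝ) ≤ p ^ 2 := by exact_mod_cast h2
  have h3 : 2 * (p : ℝ) ^ 2 ≤ p ^ 3 := by nlinarith [sq_nonneg (p : ℝ)]
  have hpp : (0 : ℝ) < p ^ 2 := by positivity
  have hpos : 0 < (p : ℝ) ^ 3 - w := by linarith
  refine ⟨hpos, ?_, ?_⟩
  · rw [balance, div_le_div_iff₀ (by positivity) hpos]
    have : (p : ℝ) ^ 3 ≤ 2 * p * w := by nlinarith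
    nlinarith
  · rw [balance, div_le_one hpos]
    linarith

/-- With `w` the size of `Ω` and `h` the balance, `(p ^ 3 - w) * h = w`, so the second moment is `w
+ w * h = p ^ 3 * h`. This makes the diagonal terms of the sieve add up to `N ^ 3 * G`. -/
theorem balanced_sums {p : ℕ} [NeZero p] (Ω : Finset (Fin 3 → ZMod p))
    (hΩ : 0 < (p : ℝ) ^ 3 - Ω.card) :
    (∑ y, (if y ∈ Ω then (-1 : ℝ) else balance p Ω.card)) = 0 ∧
      ∑ y, (if y ∈ Ω then (-1 : ℝ) else balance p Ω.card) ^ 2 =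
        (p : ℝ) ^ 3 * balance p Ω.card := by
  have hc : ((Ωᶜ).card : ℝ) = (p : ℝ) ^ 3 - Ω.card := by
    rw [Finset.card_compl, Nat.cast_sub (Finset.card_le_univ _), Fintype.card_fun, ZMod.card,
      Fintype.card_fin]
    push_cast
    rfl
  have key : ∀ a b : ℝ, ∑ y, (if y ∈ Ω then a else b) =
      Ω.card * a + ((p : ℝ) ^ 3 - Ω.card) * b := by
    intro a b
    rw [← hc, ← Finset.sum_add_sum_compl Ω]
    congr 1
    · rw [Finset.sum_congr rfl fun y hy => if_pos hy, Finset.sum_const, nsmul_eq_mul]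
    · rw [Finset.sum_congr rfl fun y hy => if_neg (Finset.mem_compl.mp hy), Finset.sum_const,
        nsmul_eq_mul]
  have hb : ((p : ℝ) ^ 3 - Ω.card) * balance p Ω.card = Ω.card := mul_div_cancel₀ _ hΩ.ne'
  simp only [ite_pow, key]
  constructor
  · linear_combination hb
  · linear_combination (balance p Ω.card - 1) * hb

instance (p : OddPrime) : Fact (p : ℕ).Prime := ⟨p.2.1⟩

theorem exists_not_isSquare_sign_mul (p : OddPrime) {ε : ℤ} (hε : ε = 1 ∨ ε = -1) :
    ∃ η : ZMod p, ¬ IsSquare ((ε : ZMod p) * η) := by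
  obtain ⟨ν, hν⟩ := FiniteField.exists_nonsquare (F := ZMod p)
    (by rw [ZMod.ringChar_zmod_n]; exact p.2.2)
  refine ⟨ε * ν, ?_⟩
  rcases hε with rfl | rfl <;> simpa using hν

/-! ### Sifting and the final count -/

/-- Sifting a cube of side `N` by the forms that are a nonresidue times a square. -/
theorem card_mul_sqrt_log_le (M : ℤ) (N : ℕ) (hN : 1 ≤ N) (S : Finset (Fin 3 → ℤ))
    (hS : S ⊆ intCube (Fin 3) M N) (η : ∀ p : OddPrime, ZMod p) (hη : ∀ p, η p ≠ 0)
    (hSη : ∀ x ∈ S, ∀ p : OddPrime, redMod p x ∉ mulSqForms (η p)) :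
    S.card * Real.sqrt (Real.log N) ≤ 15 * (N : ℝ) ^ 3 := by
  let Ω : ∀ p : OddPrime, Finset (Fin 3 → ZMod p) := fun p => mulSqForms (η p)
  let h : OddPrime → ℝ := fun p => balance p (Ω p).card
  have hb : ∀ p : OddPrime, 0 < (p : ℝ) ^ 3 - (Ω p).card ∧ 1 / (2 * (p : ℝ)) ≤ h p ∧ h p ≤ 1 :=
    fun p => balance_bounds p.2.1.two_le (sq_le_two_mul_card_mulSqForms p.2.2 (hη p))
      (card_mulSqForms_le _)
  have hh : ∀ p, 0 ≤ h p := fun p => le_trans (by positivity) (hb p).2.1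
  -- The eighth root keeps the error `3 * N ^ 2 * z ^ 4`, even times `L ≤ z`, below `3 * N ^ 3`; and
  -- `log N ≤ 8 * log (z + 1)` costs only a factor `3` after the square root.
  obtain ⟨z, hz1, hz2⟩ : ∃ z : ℕ, z ^ 8 ≤ N ∧ N < (z + 1) ^ 8 := by
    refine ⟨Nat.nthRoot 8 N, Nat.pow_nthRoot_le (Or.inl (by norm_num)),
      Nat.lt_pow_nthRoot_add_one (by norm_num) _⟩
  have hz : 1 ≤ z := by
    by_contra hz0
    have : z = 0 := by omega
    subst this
    simp at hz2
    omega
  set G := ∑ s ∈ oddPrimeSets z, ∏ p ∈ s, h p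
  have hsieve : S.card * G ^ 2 ≤ (N : ℝ) ^ 3 * G + 3 * N ^ 2 * z ^ 4 := by
    refine card_mul_sq_le_of_eq_on (q := fun p : OddPrime => (p : ℕ))
      (fun p p' hpp => (Nat.coprime_primes p.2.1 p'.2.1).mpr fun he => hpp (Subtype.ext he))
      (fun p y => if y ∈ Ω p then (-1 : ℝ) else h p) h
      (fun p => (balanced_sums (Ω p) (hb p).1).1) (fun p => (balanced_sums (Ω p) (hb p).1).2)
      (fun p y => ?_) hh (oddPrimeSets z) z (fun s hs => mem_oddPrimeSets.mp hs)
      (card_oddPrimeSets_le z) M N S hS (fun x hx s _ p _ => if_neg (hSη x hx p))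
    split_ifs
    · simp
    · rw [abs_of_nonneg (hh p)]
      exact (hb p).2.2
  have hG1 : 1 ≤ G := by
    have : (∅ : Finset OddPrime) ∈ oddPrimeSets z := mem_oddPrimeSets.mpr (by simpa using hz)
    calc (1 : ℝ) = ∏ p ∈ (∅ : Finset OddPrime), h p := by simp
      _ ≤ G := Finset.single_le_sum (f := fun s => ∏ p ∈ s, h p)
        (fun s _ => Finset.prod_nonneg fun p _ => hh p) this
  have hG2 : Real.log (z + 1) ≤ 3 * G ^ 2 :=
    (log_le_three_mul_sum_inv_prod z).trans
      (mul_le_mul_of_nonneg_left (sum_inv_prod_le_sq_sum z h fun p => (hb p).2.1) (by norm_num))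
  set L := Real.sqrt (Real.log (z + 1))
  have hz' : (1 : ℝ) ≤ z := by exact_mod_cast hz
  have hlog : 0 ≤ Real.log (z + 1) := Real.log_nonneg (by linarith)
  have hLsq : L ^ 2 = Real.log (z + 1) := Real.sq_sqrt hlog
  have hL0 : 0 ≤ L := Real.sqrt_nonneg _
  have hLG : L ≤ 2 * G := by
    refine abs_le_of_sq_le_sq' ?_ (by linarith) |>.2
    nlinarith
  have hLz : L ≤ z := by
    refine abs_le_of_sq_le_sq' ?_ (by linarith) |>.2
    have := Real.log_le_sub_one_of_pos (show (0 : ℝ) < z + 1 by linarith)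
    nlinarith
  have hNlog : Real.sqrt (Real.log N) ≤ 3 * L := by
    refine Real.sqrt_le_iff.mpr ⟨by linarith, ?_⟩
    have h8 : (N : ℝ) ≤ ((z : ℝ) + 1) ^ 8 := by exact_mod_cast hz2.le
    have := Real.log_le_log (by exact_mod_cast hN) h8
    rw [Real.log_pow] at this
    push_cast at this
    nlinarith
  have hN0 : (0 : ℝ) ≤ N := Nat.cast_nonneg N
  have hz8 : L * (z : ℝ) ^ 4 ≤ N := by
    calc L * (z : ℝ) ^ 4 ≤ (z : ℝ) * (z : ℝ) ^ 4 := by gcongr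
      _ = (z : ℝ) ^ 5 := by ring
      _ ≤ (z : ℝ) ^ 8 := pow_le_pow_right₀ hz' (by norm_num)
      _ ≤ (N : ℝ) := by exact_mod_cast hz1
  have hSL : S.card * L ≤ 5 * (N : ℝ) ^ 3 := by
    have hG0 : 0 < G ^ 2 := by positivity
    refine le_of_mul_le_mul_right ?_ hG0
    calc S.card * L * G ^ 2 = (S.card * G ^ 2) * L := by ring
      _ ≤ ((N : ℝ) ^ 3 * G + 3 * N ^ 2 * z ^ 4) * L := by gcongr
      _ = (N : ℝ) ^ 3 * G * L + 3 * N ^ 2 * (L * z ^ 4) := by ring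
      _ ≤ (N : ℝ) ^ 3 * G * (2 * G) + 3 * N ^ 2 * N := by gcongr
      _ = 2 * (N : ℝ) ^ 3 * G ^ 2 + 3 * N ^ 3 * 1 := by ring
      _ ≤ 2 * (N : ℝ) ^ 3 * G ^ 2 + 3 * N ^ 3 * G ^ 2 := by
        gcongr
        nlinarith
      _ = 5 * (N : ℝ) ^ 3 * G ^ 2 := by ring
  calc S.card * Real.sqrt (Real.log N) ≤ S.card * (3 * L) := by gcongr
    _ = 3 * (S.card * L) := by ring
    _ ≤ 3 * (5 * (N : ℝ) ^ 3) := by gcongr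
    _ = _ := by ring

/-- The part of `resTriples B` on which the resultant takes the value `ε`. -/
def signedResTriples (ε : ℤ) (B : ℝ) : Set (ℤ × ℤ × ℤ) :=
  {t | |(t.1 : ℝ)| ≤ B ∧ |(t.2.1 : ℝ)| ≤ B ∧ |(t.2.2 : ℝ)| ≤ B ∧
    ∃ R : Polynomial ℤ, Odd R.natDegree ∧ quadRes R t.1 t.2.1 t.2.2 = ε}

theorem signedResTriples_subset {ε : ℤ} (hε : ε = 1 ∨ ε = -1) (B : ℝ) :
    signedResTriples ε B ⊆ resTriples B := by
  rintro t ⟨h1, h2, h3, R, hR, h⟩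
  exact ⟨h1, h2, h3, R, hR, hε.imp (fun e => h.trans e) fun e => h.trans e⟩

theorem resTriples_eq_union (B : ℝ) :
    resTriples B = signedResTriples 1 B ∪ signedResTriples (-1) B := by
  refine Set.Subset.antisymm ?_ (Set.union_subset (signedResTriples_subset (Or.inl rfl) B)
    (signedResTriples_subset (Or.inr rfl) B))
  rintro t ⟨h1, h2, h3, R, hR, h | h⟩
  · exact Or.inl ⟨h1, h2, h3, R, hR, h⟩
  · exact Or.inr ⟨h1, h2, h3, R, hR, h⟩

theorem ncard_signedResTriples_mul_sqrt_log_le {ε : ℤ} (hε : ε = 1 ∨ ε = -1) {B : ℝ}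
    (hB : 2 ≤ B) :
    (signedResTriples ε B).ncard * Real.sqrt (Real.log B) ≤ 405 * B ^ 3 := by
  -- The choice of `η` depends on the sign `ε`, which is why the two signs are sifted separately.
  choose η hη using fun p : OddPrime => exists_not_isSquare_sign_mul p hε
  have hfin := (resTriples_finite B).subset (signedResTriples_subset hε B)
  let v : ℤ × ℤ × ℤ → Fin 3 → ℤ := fun t => ![t.1, t.2.1, t.2.2]
  have hv : Function.Injective v := by
    rintro ⟨a, b, c⟩ ⟨a', b', c'⟩ h
    exact Prod.ext (congrFun h 0) (Prod.ext (congrFun h 1) (congrFun h 2))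
  let S := hfin.toFinset.map ⟨v, hv⟩
  have hfl : 2 ≤ ⌊B⌋₊ := Nat.le_floor hB
  -- The integers of absolute value at most `B` form a half-open interval of this length starting at
  -- `-⌊B⌋₊`.
  let N := 2 * ⌊B⌋₊ + 1
  have hcube : S ⊆ intCube (Fin 3) (-⌊B⌋₊) N := by
    intro x hx
    obtain ⟨t, ht, rfl⟩ := Finset.mem_map.mp hx
    obtain ⟨h1, h2, h3, -⟩ := hfin.mem_toFinset.mp ht
    have key : ∀ n : ℤ, |(n : ℝ)| ≤ B →
        n ∈ Finset.Ico (-(⌊B⌋₊ : ℤ)) (-(⌊B⌋₊ : ℤ) + N) := by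
      intro n hn
      have : n.natAbs ≤ ⌊B⌋₊ := Nat.le_floor (by rwa [Nat.cast_natAbs, Int.cast_abs])
      rw [Finset.mem_Ico]
      simp only [N]
      omega
    refine Fintype.mem_piFinset.mpr fun i => key _ ?_
    fin_cases i
    exacts [h1, h2, h3]
  have hmain := card_mul_sqrt_log_le (-⌊B⌋₊) N (by omega) S hcube η (fun p h0 => hη p (by
    rw [h0, mul_zero]
    exact IsSquare.zero)) (by
    intro x hx p hmem
    obtain ⟨t, ht, rfl⟩ := Finset.mem_map.mp hx
    obtain ⟨-, -, -, R, hR, h⟩ := hfin.mem_toFinset.mp ht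
    obtain ⟨⟨r, s⟩, -, hrs⟩ := Finset.mem_image.mp hmem
    exact ne_mul_sq_of_quadRes hR hε h (hη p) r s
      ⟨(congrFun hrs 0).symm, (congrFun hrs 1).symm, (congrFun hrs 2).symm⟩)
  have hcard : S.card = (signedResTriples ε B).ncard := by
    rw [Finset.card_map, ← Set.ncard_eq_toFinset_card _ hfin]
  have hle : (⌊B⌋₊ : ℝ) ≤ B := Nat.floor_le (by linarith)
  have hlt : B < ⌊B⌋₊ + 1 := Nat.lt_floor_add_one B
  have hNB : B ≤ N := by
    simp only [N]
    push_cast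
    linarith
  have hNB' : (N : ℝ) ≤ 3 * B := by
    simp only [N]
    push_cast
    linarith
  rw [hcard] at hmain
  calc (signedResTriples ε B).ncard * Real.sqrt (Real.log B)
      ≤ (signedResTriples ε B).ncard * Real.sqrt (Real.log N) := by gcongr
    _ ≤ 15 * (N : ℝ) ^ 3 := hmain
    _ ≤ 15 * (3 * B) ^ 3 := by gcongr
    _ = 405 * B ^ 3 := by ring

theorem theorem1 :
    ∃ K : ℝ, 0 < K ∧ ∀ B : ℝ, 2 ≤ B →
      (countN B : ℝ) ≤ K * (B ^ 3 / Real.sqrt (Real.log B)) := by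
  refine ⟨810, by norm_num, fun B hB => ?_⟩
  have hlog : 0 < Real.sqrt (Real.log B) := Real.sqrt_pos.mpr (Real.log_pos (by linarith))
  rw [← mul_div_assoc, le_div_iff₀ hlog]
  have hunion : (countN B : ℝ) ≤
      (signedResTriples 1 B).ncard + (signedResTriples (-1) B).ncard := by
    rw [countN, resTriples_eq_union]
    exact_mod_cast Set.ncard_union_le _ _
  have h1 := ncard_signedResTriples_mul_sqrt_log_le (Or.inl rfl) hB
  have h2 := ncard_signedResTriples_mul_sqrt_log_le (Or.inr rfl) hB
  calc (countN B : ℝ) * Real.sqrt (Real.log B)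
      ≤ ((signedResTriples 1 B).ncard + (signedResTriples (-1) B).ncard) *
        Real.sqrt (Real.log B) := by gcongr
    _ ≤ 810 * B ^ 3 := by linarith
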